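/- **Definitions.** For sets $V_1,\dots,V_{k'}$ and $\bar n\in\mathbb N^{k'}$ put $V^{\bar n}=\prod_{i}V_i^{n_i}$; for $\bar v\in V^{\bar n}$, $\bar w\in V^{\bar m}$ let $\bar v\oplus\bar w\in V^{\bar n+\bar m}$ be the tuple whose $i$-th block is $\bar v_i$ followed by $\bar w_i$. Let $\bar\delta_i$ be the $i$-th unit vector and $\bar 1=(1,\dots,1)$. A *$k'$-partite graded probability space* on $V_1,\dots,V_{k'}$ consists of, for every $\bar n\in\mathbb N^{k'}$, a $\sigma$-algebra $\mathcal B_{\bar n}$ on $V^{\bar n}$ and a probability measure $\mu_{\bar n}$ on $\mathcal B_{\bar n}$ such that: (1) for each $i$, permuting the coordinates within the $i$-th block maps $\mathcal B_{\bar n}$ to itself and preserves $\mu_{\bar n}$; (2) if $B\in\mathcal B_{\bar n}$ and $C\in\mathcal B_{\bar m}$, then $\{\bar v\oplus\bar w:\bar v\in B,\bar w\in C\}\in\mathcal B_{\bar n+\bar m}$; (3) for $B\in\mathcal B_{\bar n+\bar m}$ and $B_{\bar w}=\{\bar v:\bar v\oplus\bar w\in B\}$, we have $B_{\bar w}\in\mathcal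 B_{\bar n}$ for every $\bar w\in V^{\bar m}$, the function $\bar w\mapsto\mu_{\bar n}(B_{\bar w})$ is $\mathcal B_{\bar m}$-measurable, and $\mu_{\bar n+\bar m}(B)=\int\mu_{\bar n}(B_{\bar w})\,d\mu_{\bar m}(\bar w)$. Let $f:\prod_{i\in[k+1]}W_i\to[0,1]$ and $0\le r<s\le1$. A box $A=A_1\times\dots\times A_k$, $A_i\subseteq W_i$, is *$(r,s)$-shattered* by $f$ if for every $S\subseteq A$ there is $c_S\in W_{k+1}$ with $f(\bar a,c_S)\le r$ for all $\bar a\in S$ and $f(\bar a,c_S)\ge s$ for all $\bar a\in A\setminus S$. For $k'>k$ and $f:\prod_{i\in[k']}V_i\to[0,1]$, we say $\mathrm{VC}_k(f)<\infty$ if there are numbers $d_{r,s}\in\mathbb N$ ($0\le r<s\le 1$) such that for every $I\subseteq[k']$ with $|I|=k'-(k+1)$ and every $b\in\prod_{i\in I}V_i$, no box with all sides of size $d_{r,s}$ is $(r,s)$-shattered by the fiber $f_b:\prod_{i\in[k']\setminus I}V_i\to[0,1]$ (with its $k+1$ coordinates in increasing order). **Theorem.** Let $k'>k$ be natural numbers,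 $V_1,\dots,V_{k'}$ sets and $f:\prod_{i\in[k']}V_i\to[0,1]$. Suppose that for every $\varepsilon>0$ there is $N\in\mathbb N$ such that for every $k'$-partite graded probability space on $V_1,\dots,V_{k'}$ for which $f$ is $\mathcal B_{\bar 1}$-measurable, there is a function $g:\prod_{i\in[k']}V_i\to[0,1]$ of the form $$g(\bar x)=\sum_{j=1}^{N}\gamma_j\prod_{I\subseteq[k'],\,|I|\le k}f^j_I(\bar x_I),$$ with $\gamma_j\in\mathbb R$ and each $f^j_I:\prod_{i\in I}V_i\to\mathbb R$ being $\mathcal B_{\sum_{i\in I}\bar\delta_i}$-measurable, such that $\|f-g\|_{L^2(\mu_{\bar 1})}<\varepsilon$. Then $\mathrm{VC}_k(f)<\infty$. Moreover, for this conclusion it is enough that the approximation property (for every $\varepsilon$ there is $N$) holds over those $k'$-partite graded probability spaces in which every $\mathcal B_{\bar n}$ is the full power set of $V^{\bar n}$ and each $\mu_{\bar\delta_i}$, $i\in[k']$, is finitely supported. -/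

import Mathlib

open MeasureTheory

universe u

namespace GradedVC

/-- The product `∏ i, (V i) ^ (n i)`: for each part `i`, a tuple of length `n i` from `V i`. -/
abbrev Tup {k : ℕ} (V : Fin k → Type u) (n : Fin k → ℕ) : Type u :=
  ∀ i, Fin (n i) → V i

/-- Ordered concatenation `v ⊕ w`, part by part. -/
def concat {k : ℕ} {V : Fin k → Type u} {n m : Fin k → ℕ} (v : Tup V n) (w : Tup V m) :
    Tup V (n + m) :=
  fun i => Fin.append (v i) (w i)

/-- Permuting the coordinates of the `i`-th block of a tuple. -/
def permBlock {k : ℕ} {V : Fin k → Type u} {n : Fin k → ℕ} (i : Fin k)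
    (π : Equiv.Perm (Fin (n i))) (v : Tup V n) : Tup V n :=
  Function.update v i (fun j => v i (π j))

/-- A `k`-partite graded probability space on the sets `V 0, …, V (k - 1)`. -/
structure GradedProbSpace {k : ℕ} (V : Fin k → Type u) where
  /-- the σ-algebra on `∏ i, (V i) ^ (n i)` -/
  B : ∀ n : Fin k → ℕ, MeasurableSpace (Tup V n)
  /-- the measure on it -/
  μ : ∀ n : Fin k → ℕ, @Measure (Tup V n) (B n)
  isProb : ∀ n, @IsProbabilityMeasure (Tup V n) (B n) (μ n)
  symm_measurable : ∀ (n : Fin k → ℕ) (i : Fin k) (π : Equiv.Perm (Fin (n i)))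
    (S : Set (Tup V n)), MeasurableSet[B n] S → MeasurableSet[B n] (permBlock i π '' S)
  symm_measure : ∀ (n : Fin k → ℕ) (i : Fin k) (π : Equiv.Perm (Fin (n i)))
    (S : Set (Tup V n)), MeasurableSet[B n] S → μ n (permBlock i π '' S) = μ n S
  prod_measurable : ∀ (n m : Fin k → ℕ) (S : Set (Tup V n)) (T : Set (Tup V m)),
    MeasurableSet[B n] S → MeasurableSet[B m] T →
      MeasurableSet[B (n + m)] (Set.image2 concat S T)
  section_measurable : ∀ (n m : Fin k → ℕ) (S : Set (Tup V (n + m))),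
    MeasurableSet[B (n + m)] S → ∀ w : Tup V m, MeasurableSet[B n] {v | concat v w ∈ S}
  section_measure_measurable : ∀ (n m : Fin k → ℕ) (S : Set (Tup V (n + m))),
    MeasurableSet[B (n + m)] S →
      @Measurable _ _ (B m) _ (fun w : Tup V m => μ n {v | concat v w ∈ S})
  fubini : ∀ (n m : Fin k → ℕ) (S : Set (Tup V (n + m))),
    MeasurableSet[B (n + m)] S →
      μ (n + m) S = @lintegral _ (B m) (μ m) (fun w : Tup V m => μ n {v | concat v w ∈ S})

/-- The multi-index `∑ i ∈ I, δ_i`. -/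
def idx {k : ℕ} (I : Finset (Fin k)) : Fin k → ℕ := fun i => if i ∈ I then 1 else 0

/-- The identification of `∏ i, (V i) ^ (idx I i)` with `∏ i ∈ I, V i`. -/
def toSub {k : ℕ} {V : Fin k → Type u} (I : Finset (Fin k)) (v : Tup V (idx I)) :
    ∀ i : I, V i :=
  fun i => v i ⟨0, by simp [idx, i.2]⟩

/-- The multi-index `(1, …, 1)`. -/
def ones (k : ℕ) : Fin k → ℕ := fun _ => 1

/-- The identification of `∏ i, (V i) ^ 1` with `∏ i, V i`. -/
def toFull {k : ℕ} {V : Fin k → Type u} (v : Tup V (ones k)) : ∀ i, V i :=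
  fun i => v i (0 : Fin 1)

namespace GradedProbSpace

variable {k' : ℕ} {V : Fin k' → Type u}

/-- `f : ∏ i, V i → ℝ` is measurable for the σ-algebra of multi-index `(1, …, 1)`. -/
def MeasurableFull (P : GradedProbSpace V) (f : (∀ i, V i) → ℝ) : Prop :=
  @Measurable _ _ (P.B (ones k')) _ (fun v : Tup V (ones k') => f (toFull v))

/-- `φ : ∏ i ∈ I, V i → ℝ` is measurable for the σ-algebra of multi-index `∑ i ∈ I, δ_i`. -/
def MeasurableSub (P : GradedProbSpace V) (I : Finset (Fin k')) (φ : (∀ i : I, V i) → ℝ) :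
    Prop :=
  @Measurable _ _ (P.B (idx I)) _ (fun v : Tup V (idx I) => φ (toSub I v))

/-- The `L²`-norm for the measure of multi-index `(1, …, 1)`. -/
noncomputable def l2norm (P : GradedProbSpace V) (h : (∀ i, V i) → ℝ) : ENNReal :=
  @eLpNorm _ ℝ _ (P.B (ones k')) (fun v : Tup V (ones k') => h (toFull v)) 2 (P.μ (ones k'))

/-- `f` is within `ε`, in `L²`, of a `[0,1]`-valued function that is a linear combination of `N`
products of measurable functions of at most `k` of the variables. -/
def Approximable (P : GradedProbSpace V) (k : ℕ) (f : (∀ i, V i) → ℝ) (ε : ℝ) (N : ℕ) : Prop :=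
  ∃ (γ : Fin N → ℝ) (φ : Fin N → ∀ I : Finset (Fin k'), (∀ i : I, V i) → ℝ)
    (g : (∀ i, V i) → ℝ),
    (∀ j I, I.card ≤ k → P.MeasurableSub I (φ j I)) ∧
    (∀ x, g x = ∑ j, γ j *
      ∏ I ∈ Finset.univ.filter (fun I : Finset (Fin k') => I.card ≤ k), φ j I (fun i => x i)) ∧
    (∀ x, g x ∈ Set.Icc (0 : ℝ) 1) ∧
    P.l2norm (fun x => f x - g x) < ENNReal.ofReal ε

/-- Every σ-algebra of the space is the full power set. -/
def IsDiscrete (P : GradedProbSpace V) : Prop := ∀ n, P.B n = ⊤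

/-- Each of the measures on the single sets `V i` is concentrated on a finite set. -/
def FinitelySupported (P : GradedProbSpace V) : Prop :=
  ∀ i : Fin k', ∃ F : Set (V i), F.Finite ∧
    P.μ (idx {i}) {v | toSub {i} v ⟨i, Finset.mem_singleton_self i⟩ ∉ F} = 0

end GradedProbSpace

/-- The box `∏ j, A j`, in the first `k` coordinates, is `(r,s)`-shattered by the `(k+1)`-ary
function `f`. -/
def Shatters {k : ℕ} {W : Fin (k + 1) → Type u} (f : (∀ j, W j) → ℝ) (r s : ℝ)
    (A : ∀ j : Fin k, Finset (W j.castSucc)) : Prop :=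
  ∀ S : Set (∀ j : Fin k, W j.castSucc), S ⊆ {a | ∀ j, a j ∈ A j} →
    ∃ c : W (Fin.last k),
      (∀ a ∈ S, f (Fin.snoc (α := W) a c) ≤ r) ∧
      (∀ a ∈ {a | ∀ j, a j ∈ A j} \ S, s ≤ f (Fin.snoc (α := W) a c))

/-- `VC_k(f) ≤ d` for a `(k+1)`-ary function `f`. -/
def VCLeBase {k : ℕ} {W : Fin (k + 1) → Type u} (f : (∀ j, W j) → ℝ) (d : ℝ → ℝ → ℕ) : Prop :=
  ∀ r ∈ Set.Icc (0 : ℝ) 1, ∀ s ∈ Set.Icc (0 : ℝ) 1, r < s →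
    ¬ ∃ A : ∀ j : Fin k, Finset (W j.castSucc), (∀ j, (A j).card = d r s) ∧ Shatters f r s A

/-- The increasing enumeration of the complement of `I`. -/
def enumCompl {k k' : ℕ} (I : Finset (Fin k')) (hI : I.card + (k + 1) = k') :
    Fin (k + 1) ≃o (Iᶜ : Finset (Fin k')) :=
  Finset.orderIsoOfFin Iᶜ (by rw [Finset.card_compl, Fintype.card_fin]; omega)

/-- The fiber `f_b`, where the coordinates in `I` are fixed to be `b`, as a function of the
remaining `k + 1` coordinates taken in increasing order. -/
def fiber {k k' : ℕ} {V : Fin k' → Type u} (f : (∀ i, V i) → ℝ) (I : Finset (Fin k'))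
    (hI : I.card + (k + 1) = k') (b : ∀ i : I, V i) (x : ∀ j, V (enumCompl I hI j)) : ℝ :=
  f (fun i => if hi : i ∈ I then b ⟨i, hi⟩ else
    Equiv.piCongrLeft (fun i : (Iᶜ : Finset (Fin k')) => V i) (enumCompl I hI).toEquiv x
      ⟨i, Finset.mem_compl.mpr hi⟩)

/-- `VC_k(f) ≤ d` for a `k'`-ary function `f`: this bound holds for all `(k+1)`-ary fibers
(and holds trivially if `k' ≤ k`). -/
def VCLe {k' : ℕ} {V : Fin k' → Type u} (k : ℕ) (f : (∀ i, V i) → ℝ) (d : ℝ → ℝ → ℕ) : Prop :=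
  ∀ (I : Finset (Fin k')) (hI : I.card + (k + 1) = k') (b : ∀ i : I, V i),
    VCLeBase (fiber f I hI b) d

/-- `VC_k(f) < ∞`. -/
def FiniteVC {k' : ℕ} {V : Fin k' → Type u} (k : ℕ) (f : (∀ i, V i) → ℝ) : Prop :=
  ∃ d : ℝ → ℝ → ℕ, VCLe k f d

end GradedVC

/-! Suppose a fiber shatters a box of side `d` in `k` coordinates. Put uniform measures on its sides
and on a set of witnesses `c σ`, one for each of the `2 ^ (d ^ k)` patterns `σ`, and point masses at
`b`. Then `f` has an approximant `g` with `N` terms, `N` independent of `d`. A factor of `g`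
involving the witness coordinate has at most `k` variables, so it misses a coordinate of the box.
Hence, for fixed `N`, `g(·, c σ)` depends on `σ` only through O(d^(k-1)) real parameters.

Read `g(·, c σ)` as a slightly biased coin at each point `a` of the box, tilted towards `σ a`. The
matrix whose entry at `(σ', σ)` is the probability that the coins of `σ'` produce `σ` is stochastic,
and it factors through monomials of degree at most `d` in each parameter. So its trace is at most
(d+1)^O(d^(k-1)) (`trace_mul_le_card`, `sum_prod_le_pow`). But `g` is close to `f`, so on average
the coins of `σ` guess `σ` better than chance, and the trace is at least exp(c d^k) with c > 0
(`exp_le_sum_prod`). For large `d` this is impossible (`exists_pow_lt_exp`). -/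

namespace GradedVC

open Finset

/-! ### Trace of a stochastic matrix of low rank -/

/-- The trace of a product `X * Y` of real matrices all of whose rows have absolute sum at most `1`
is bounded by the inner dimension. -/
theorem trace_mul_le_card {m r : Type*} [Fintype m] [Fintype r] [DecidableEq r]
    (X : Matrix m r ℝ) (Y : Matrix r m ℝ) (h : ∀ i, ∑ j, |(X * Y) i j| ≤ 1) :
    (X * Y).trace ≤ Fintype.card r := by
  classical
  set X' : Matrix m r ℂ := X.map (algebraMap ℝ ℂ) with hX'
  set Y' : Matrix r m ℂ := Y.map (algebraMap ℝ ℂ) with hY'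
  have hXY : X' * Y' = (X * Y).map (algebraMap ℝ ℂ) := by
    rw [hX', hY', Matrix.map_mul]
  have hroot : ∀ z ∈ (Y' * X').charpoly.roots, ‖z‖ ≤ 1 := by
    intro z hz
    have hz' : Module.End.HasEigenvalue (Matrix.toLin' (Y' * X')) z := by
      rw [Module.End.hasEigenvalue_iff_isRoot_charpoly, Matrix.charpoly_toLin']
      exact Polynomial.isRoot_of_mem_roots hz
    obtain ⟨v, hv⟩ := hz'.exists_hasEigenvector
    have hv0 := hv.2
    have hv1 : (Y' * X').mulVec v = z • v := by
      have := hv.apply_eq_smul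
      rwa [Matrix.toLin'_apply] at this
    by_cases hz0 : z = 0
    · simp [hz0]
    -- A nonzero eigenvalue of `Y' * X'` is one of `X' * Y'`, with eigenvector `X' v`; the row sums
    -- make `X' * Y'` a contraction in the sup norm.
    set w := X'.mulVec v with hw
    have hw1 : (X' * Y').mulVec w = z • w := by
      rw [hw, ← Matrix.mulVec_smul, ← hv1, Matrix.mulVec_mulVec, Matrix.mulVec_mulVec,
        Matrix.mul_assoc]
    have hw0 : w ≠ 0 := by
      intro h0
      rw [← Matrix.mulVec_mulVec, ← hw, h0, Matrix.mulVec_zero] at hv1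
      exact (smul_ne_zero hz0 hv0) hv1.symm
    have hle : ‖z • w‖ ≤ ‖w‖ := by
      rw [← hw1]
      refine (pi_norm_le_iff_of_nonneg (norm_nonneg _)).2 fun i => ?_
      calc ‖(X' * Y').mulVec w i‖ = ‖∑ j, (X' * Y') i j * w j‖ := rfl
        _ ≤ ∑ j, |(X * Y) i j| * ‖w‖ := by
            refine (norm_sum_le _ _).trans (sum_le_sum fun j _ => ?_)
            rw [norm_mul, hXY]
            refine mul_le_mul ?_ (norm_le_pi_norm w j) (norm_nonneg _) (abs_nonneg _)
            simp
        _ = (∑ j, |(X * Y) i j|) * ‖w‖ := by rw [sum_mul]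
        _ ≤ 1 * ‖w‖ := mul_le_mul_of_nonneg_right (h i) (norm_nonneg _)
        _ = ‖w‖ := one_mul _
    rw [norm_smul] at hle
    have := norm_pos_iff.2 hw0
    nlinarith
  -- The other order `Y' * X'` has the small size, hence at most `card r` eigenvalues.
  have htr : (((X * Y).trace : ℝ) : ℂ) = (Y' * X').charpoly.roots.sum := by
    rw [← Matrix.trace_eq_sum_roots_charpoly, Matrix.trace_mul_comm Y', hXY]
    simp [Matrix.trace]
  have h1 : ‖(Y' * X').charpoly.roots.sum‖ ≤ Fintype.card r := by
    refine (Multiset.le_sum_of_subadditive (fun z : ℂ => ‖z‖) norm_zero.le norm_add_le _).trans ?_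
    refine (Multiset.sum_le_card_nsmul _ 1 ?_).trans ?_
    · intro x hx
      obtain ⟨z, hz, rfl⟩ := Multiset.mem_map.1 hx
      exact hroot z hz
    · rw [Multiset.card_map, nsmul_eq_mul, mul_one]
      have := Polynomial.card_roots' (Y' * X').charpoly
      rw [Matrix.charpoly_natDegree_eq_dim] at this
      exact_mod_cast this
  rw [← htr, Complex.norm_real] at h1
  exact (le_abs_self _).trans h1

/-- Let the functions `z true σ, z false σ : α → [0, 1]` add up to `1` and be sums of monomials in
parameters `θ σ`, each parameter having degree at most `d` in every product over `α` of monomials.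
Then the likelihoods `∏ a, z (σ a) σ a` add up to at most `(d + 1) ^ #parameters`. -/
theorem sum_prod_le_pow {α Θ J P : Type*} [Fintype α] [Fintype Θ] [Fintype J] [Fintype P]
    [DecidableEq α] [DecidableEq Θ] (τ : J → α → P → Θ) (θ : (α → Bool) → Θ → ℝ)
    (K : Bool → J → α → ℝ) (z : Bool → (α → Bool) → α → ℝ) (d : ℕ)
    (hz : ∀ b σ a, z b σ a = ∑ j, K b j a * ∏ p, θ σ (τ j a p))
    (hz0 : ∀ b σ a, 0 ≤ z b σ a) (hz1 : ∀ σ a, z true σ a + z false σ a = 1)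
    (hd : ∀ (ι : α → J) (t : Θ),
      #{x : α × P | τ (ι x.1) x.1 x.2 = t} ≤ d) :
    ∑ σ : α → Bool, ∏ a, z (σ a) σ a ≤ ((d + 1 : ℕ) : ℝ) ^ Fintype.card Θ := by
  classical
  -- Expanding a likelihood means choosing a term `ι a` at each `a`. Grouping the choices by their
  -- exponent vectors `ex ι` gives the inner dimension.
  let ex : (α → J) → Θ → Fin (d + 1) := fun ι t =>
    ⟨#{x : α × P | τ (ι x.1) x.1 x.2 = t}, Nat.lt_succ_of_le (hd ι t)⟩
  let X : Matrix (α → Bool) (Θ → Fin (d + 1)) ℝ := fun σ e => ∏ t, θ σ t ^ (e t : ℕ)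
  let Y : Matrix (Θ → Fin (d + 1)) (α → Bool) ℝ := fun e σ =>
    ∑ ι : α → J with ex ι = e, ∏ a, K (σ a) (ι a) a
  have hXY : ∀ σ' σ, (X * Y) σ' σ = ∏ a, z (σ a) σ' a := by
    intro σ' σ
    have hm : ∀ ι : α → J, ∏ a, ∏ p, θ σ' (τ (ι a) a p) = X σ' (ex ι) := by
      intro ι
      rw [← Fintype.prod_prod_type' (fun a p => θ σ' (τ (ι a) a p)),
        ← prod_fiberwise univ (fun x : α × P => τ (ι x.1) x.1 x.2)]
      refine prod_congr rfl fun t _ => ?_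
      rw [prod_congr rfl (g := fun _ => θ σ' t), prod_const]
      intro x hx
      rw [(mem_filter.1 hx).2]
    rw [Matrix.mul_apply]
    simp_rw [hz]
    rw [prod_univ_sum, Fintype.piFinset_univ, ← sum_fiberwise univ ex]
    refine sum_congr rfl fun e _ => ?_
    rw [mul_sum]
    refine sum_congr rfl fun ι hι => ?_
    rw [prod_mul_distrib, hm, (mem_filter.1 hι).2, mul_comm]
  -- Row `σ'` is a product probability distribution on the patterns.
  have hrow : ∀ σ', ∑ σ, |(X * Y) σ' σ| ≤ 1 := by
    intro σ'
    have : ∏ a, ∑ b, z b σ' a = ∑ σ : α → Bool, ∏ a, z (σ a) σ' a := by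
      rw [prod_univ_sum, Fintype.piFinset_univ]
    simp_rw [hXY]
    rw [sum_congr rfl fun σ _ => abs_of_nonneg (prod_nonneg fun a _ => hz0 (σ a) σ' a), ← this]
    simp [hz1]
  have := trace_mul_le_card X Y hrow
  simpa [Matrix.trace, hXY] using this

/-! ### Exponential estimates -/

theorem exp_sub_two_mul_sq_le {u : ℝ} (hu : |u| ≤ 1 / 8) : Real.exp (u - 2 * u ^ 2) ≤ 1 + u := by
  obtain ⟨h1, h2⟩ := abs_le.1 hu
  have ht : |u - 2 * u ^ 2| ≤ 1 := by
    rw [abs_le]; constructor <;> nlinarith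
  have h := (abs_le.1 (Real.abs_exp_sub_one_sub_id_le ht)).2
  have h3 : (1 - 2 * u) ^ 2 ≤ 2 := by nlinarith
  nlinarith [mul_le_mul_of_nonneg_left h3 (sq_nonneg u)]

/-- If the average of `u σ a` is at least `c` and `|u σ a| ≤ l`, then the average over `σ` of
`∏ a, (1 + u σ a)` is at least `exp (|α| (c - 2 l ^ 2))`. -/
theorem exp_le_sum_prod {α β : Type*} [Fintype α] [Fintype β] (u : β → α → ℝ) {c l : ℝ}
    (hl : l ≤ 1 / 8) (hu : ∀ σ a, |u σ a| ≤ l)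
    (hc : c * (Fintype.card α * Fintype.card β) ≤ ∑ σ, ∑ a, u σ a) :
    Fintype.card β * Real.exp (Fintype.card α * (c - 2 * l ^ 2)) ≤ ∑ σ, ∏ a, (1 + u σ a) := by
  set y := Fintype.card α * (c - 2 * l ^ 2) with hy
  -- Tangent line of `exp` at `y`: after summing over `σ`, the linear correction is nonnegative by
  -- `hc`.
  have h1 : ∀ σ, Real.exp y * (1 + ((∑ a, u σ a) - Fintype.card α * (2 * l ^ 2) - y)) ≤
      ∏ a, (1 + u σ a) := by
    intro σ
    calc _ ≤ Real.exp y * Real.exp ((∑ a, u σ a) - Fintype.card α * (2 * l ^ 2) - y) := by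
          refine mul_le_mul_of_nonneg_left ?_ (Real.exp_pos _).le
          rw [add_comm]; exact Real.add_one_le_exp _
      _ = Real.exp (∑ a, (u σ a - 2 * l ^ 2)) := by
          rw [← Real.exp_add]; congr 1; simp [sum_sub_distrib]
      _ = ∏ a, Real.exp (u σ a - 2 * l ^ 2) := Real.exp_sum _ _
      _ ≤ ∏ a, (1 + u σ a) := by
          refine prod_le_prod (fun a _ => (Real.exp_pos _).le) fun a _ => ?_
          refine le_trans (Real.exp_le_exp.2 ?_) (exp_sub_two_mul_sq_le ((hu σ a).trans hl))
          have := sq_le_sq' (abs_le.1 (hu σ a)).1 (abs_le.1 (hu σ a)).2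
          linarith
  refine le_trans ?_ (sum_le_sum fun σ _ => h1 σ)
  rw [← mul_sum]
  simp only [sum_add_distrib, sum_sub_distrib, sum_const, card_univ, nsmul_eq_mul, mul_one]
  rw [mul_comm]
  refine mul_le_mul_of_nonneg_left ?_ (Real.exp_pos _).le
  rw [hy]
  linarith

/-- After taking logarithms and cancelling `d ^ (k - 1)`, linear growth beats `log (d + 1)`. The
factor `k` in the bound forces `n = 0` when `k = 0`, where the subtraction truncates. -/
theorem exists_pow_lt_exp (k C : ℕ) {c : ℝ} (hc : 0 < c) :
    ∃ d : ℕ, 0 < d ∧ ∀ n : ℕ, n ≤ k * C * d ^ (k - 1) →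
      ((d + 1 : ℕ) : ℝ) ^ n < Real.exp (((d ^ k : ℕ) : ℝ) * c) := by
  obtain ⟨d, hd0, hd⟩ : ∃ d : ℕ, 0 < d ∧ (k * C : ℝ) * Real.log ((d + 1 : ℕ) : ℝ) < d * c := by
    have h1 : Filter.Tendsto (fun d : ℕ => Real.log ((d + 1 : ℕ) : ℝ) / ((d + 1 : ℕ) : ℝ))
        Filter.atTop (nhds 0) := by
      have := (Real.isLittleO_log_id_atTop.tendsto_div_nhds_zero).comp
        (tendsto_natCast_atTop_atTop.comp (Filter.tendsto_add_atTop_nat 1))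
      exact this
    -- The factor 2 absorbs `d + 1 ≤ 2 * d`.
    have h2 := h1.const_mul (2 * (k * C : ℝ))
    rw [mul_zero] at h2
    obtain ⟨d, h3, h4⟩ := ((h2.eventually (gt_mem_nhds hc)).and
      (Filter.eventually_gt_atTop 0)).exists
    refine ⟨d, h4, ?_⟩
    have h5 : (0 : ℝ) < ((d + 1 : ℕ) : ℝ) := by positivity
    rw [← mul_div_assoc, div_lt_iff₀ h5] at h3
    have h6 : (1 : ℝ) ≤ d := by exact_mod_cast h4
    push_cast at h3 ⊢
    nlinarith
  refine ⟨d, hd0, fun n hn => ?_⟩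
  rw [← Real.log_lt_iff_lt_exp (by positivity), Real.log_pow]
  have hlog : 0 ≤ Real.log ((d + 1 : ℕ) : ℝ) := Real.log_natCast_nonneg _
  have hn' : (n : ℝ) ≤ k * C * d ^ (k - 1) := by exact_mod_cast hn
  refine (mul_le_mul_of_nonneg_right hn' hlog).trans_lt ?_
  rcases k with _ | k
  · simpa using hc
  · have h7 : (0 : ℝ) < (d : ℝ) ^ k := by positivity
    have := mul_lt_mul_of_pos_left hd h7
    simp only [Nat.add_sub_cancel]
    push_cast at this ⊢
    rw [pow_succ]
    linarith

/-! ### Uniform graded probability spaces on finite sets -/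

section Uniform

variable {k' : ℕ} {V : Fin k' → Type u}

/-- The tuples all of whose entries from `V i` lie in `F i`. -/
def tupFinset (F : ∀ i, Finset (V i)) (n : Fin k' → ℕ) : Finset (Tup V n) :=
  Fintype.piFinset fun i => Fintype.piFinset fun _ => F i

theorem mem_tupFinset {F : ∀ i, Finset (V i)} {n : Fin k' → ℕ} {v : Tup V n} :
    v ∈ tupFinset F n ↔ ∀ i j, v i j ∈ F i := by
  simp [tupFinset]

theorem tupFinset_nonempty {F : ∀ i, Finset (V i)} (hF : ∀ i, (F i).Nonempty) (n : Fin k' → ℕ) :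
    (tupFinset F n).Nonempty :=
  ⟨fun i _ => (hF i).choose, mem_tupFinset.2 fun i _ => (hF i).choose_spec⟩

theorem concat_mem_tupFinset {F : ∀ i, Finset (V i)} {n m : Fin k' → ℕ} {v : Tup V n}
    {w : Tup V m} : concat v w ∈ tupFinset F (n + m) ↔ v ∈ tupFinset F n ∧ w ∈ tupFinset F m := by
  simp only [mem_tupFinset]
  constructor
  · intro h
    refine ⟨fun i j => ?_, fun i j => ?_⟩
    · simpa [concat] using h i (Fin.castAdd (m i) j)
    · simpa [concat] using h i (Fin.natAdd (n i) j)
  · rintro ⟨h1, h2⟩ i j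
    change Fin.append (v i) (w i) j ∈ F i
    refine Fin.addCases (motive := fun j => Fin.append (v i) (w i) j ∈ F i) ?_ ?_ j
    · intro j; simpa using h1 i j
    · intro j; simpa using h2 i j

/-- Concatenation as an equivalence. -/
def concatEquiv (V : Fin k' → Type u) (n m : Fin k' → ℕ) :
    Tup V n × Tup V m ≃ Tup V (n + m) where
  toFun p := concat p.1 p.2
  invFun u := (fun i j => u i (Fin.castAdd (m i) j), fun i j => u i (Fin.natAdd (n i) j))
  left_inv p := by
    ext i j <;> simp [concat]
  right_inv u := by
    funext i
    exact Fin.append_castAdd_natAdd (f := u i)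

theorem sum_tupFinset_add {M : Type*} [AddCommMonoid M] (F : ∀ i, Finset (V i))
    (n m : Fin k' → ℕ) (φ : Tup V (n + m) → M) :
    ∑ u ∈ tupFinset F (n + m), φ u =
      ∑ w ∈ tupFinset F m, ∑ v ∈ tupFinset F n, φ (concat v w) := by
  rw [sum_comm, ← sum_product']
  refine (sum_equiv (concatEquiv V n m) (fun p => ?_) fun p _ => rfl).symm
  rw [mem_product]
  exact concat_mem_tupFinset.symm

theorem card_tupFinset_add (F : ∀ i, Finset (V i)) (n m : Fin k' → ℕ) :
    #(tupFinset F (n + m)) = #(tupFinset F m) * #(tupFinset F n) := by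
  rw [card_eq_sum_ones, sum_tupFinset_add]
  simp

theorem permBlock_injective {n : Fin k' → ℕ} (i : Fin k') (π : Equiv.Perm (Fin (n i))) :
    Function.Injective (permBlock (V := V) i π) := by
  intro v w h
  funext i' j
  have h1 := congrFun h i'
  by_cases hi : i' = i
  · subst hi
    have := congrFun h1 (π.symm j)
    simpa [permBlock] using this
  · simpa [permBlock, hi] using congrFun h1 j

theorem permBlock_mem_tupFinset {F : ∀ i, Finset (V i)} {n : Fin k' → ℕ} (i : Fin k')
    (π : Equiv.Perm (Fin (n i))) {v : Tup V n} (hv : v ∈ tupFinset F n) :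
    permBlock i π v ∈ tupFinset F n := by
  rw [mem_tupFinset] at hv ⊢
  intro i' j
  by_cases hi : i' = i
  · subst hi
    simpa [permBlock] using hv i' (π j)
  · simpa [permBlock, hi] using hv i' j

/-- The uniform measure on a finite set, defined on the full power set. -/
noncomputable def unifMeasure {Ω : Type*} (T : Finset Ω) : @Measure Ω ⊤ :=
  letI : MeasurableSpace Ω := ⊤
  (#T : ENNReal)⁻¹ • ∑ v ∈ T, Measure.dirac v

theorem lintegral_unifMeasure {Ω : Type*} (T : Finset Ω) (φ : Ω → ENNReal) :
    @lintegral Ω ⊤ (unifMeasure T) φ = (#T : ENNReal)⁻¹ * ∑ v ∈ T, φ v := by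
  let _ : MeasurableSpace Ω := ⊤
  have : MeasurableSingletonClass Ω := ⟨fun _ => trivial⟩
  unfold unifMeasure
  rw [lintegral_smul_measure, lintegral_finsetSum_measure, smul_eq_mul]
  simp only [lintegral_dirac]

theorem unifMeasure_apply {Ω : Type*} (T : Finset Ω) (S : Set Ω) :
    unifMeasure T S = (#T : ENNReal)⁻¹ * ∑ v ∈ T, S.indicator 1 v := by
  let _ : MeasurableSpace Ω := ⊤
  rw [← lintegral_unifMeasure]
  exact (lintegral_indicator_one (μ := unifMeasure T) (s := S) trivial).symm

/-- The graded probability space given by the uniform measures on finite nonempty sets `F i`. -/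
noncomputable def unifSpace (F : ∀ i, Finset (V i)) (hF : ∀ i, (F i).Nonempty) :
    GradedProbSpace V where
  B _ := ⊤
  μ n := unifMeasure (tupFinset F n)
  isProb n := by
    let _ : MeasurableSpace (Tup V n) := ⊤
    refine ⟨?_⟩
    rw [unifMeasure_apply]
    simp only [Set.indicator_univ, Pi.one_apply, sum_const, nsmul_eq_mul, mul_one]
    exact ENNReal.inv_mul_cancel (by simpa using (tupFinset_nonempty hF n).ne_empty)
      (ENNReal.natCast_ne_top _)
  symm_measurable _ _ _ _ _ := trivial
  symm_measure n i π S _ := by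
    rw [unifMeasure_apply, unifMeasure_apply]
    congr 1
    have himg : (tupFinset F n).map ⟨permBlock i π, permBlock_injective i π⟩ = tupFinset F n := by
      refine eq_of_subset_of_card_le ?_ (card_map _).ge
      intro v hv
      obtain ⟨w, hw, rfl⟩ := mem_map.1 hv
      exact permBlock_mem_tupFinset i π hw
    conv_lhs => rw [← himg]
    rw [sum_map]
    refine sum_congr rfl fun v _ => ?_
    by_cases hv : v ∈ S
    · have hv' := Set.mem_image_of_mem (permBlock i π) hv
      simp [hv, hv']
    · have hv' : permBlock i π v ∉ permBlock i π '' S := by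
        rwa [(permBlock_injective i π).mem_set_image]
      rw [Function.Embedding.coeFn_mk, Set.indicator_of_notMem hv, Set.indicator_of_notMem hv']
  prod_measurable _ _ _ _ _ _ := trivial
  section_measurable _ _ _ _ _ := trivial
  section_measure_measurable _ _ _ _ := measurable_from_top
  fubini n m S _ := by
    rw [lintegral_unifMeasure]
    simp_rw [unifMeasure_apply]
    rw [card_tupFinset_add, sum_tupFinset_add, ← mul_sum, ← mul_assoc, Nat.cast_mul,
      ENNReal.mul_inv (Or.inr (ENNReal.natCast_ne_top _)) (Or.inl (ENNReal.natCast_ne_top _))]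
    rfl

theorem unifSpace_isDiscrete (F : ∀ i, Finset (V i)) (hF : ∀ i, (F i).Nonempty) :
    (unifSpace F hF).IsDiscrete := fun _ => rfl

theorem unifSpace_finitelySupported (F : ∀ i, Finset (V i)) (hF : ∀ i, (F i).Nonempty) :
    (unifSpace F hF).FinitelySupported := by
  intro i
  refine ⟨F i, (F i).finite_toSet, ?_⟩
  change unifMeasure (tupFinset F (idx {i})) _ = 0
  rw [unifMeasure_apply, sum_eq_zero, mul_zero]
  intro v hv
  refine Set.indicator_of_notMem ?_ _
  simp only [Set.mem_ofPred_eq, not_not]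
  exact mem_tupFinset.1 hv i _

/-- A bound for the `L²`-norm over the uniform space bounds the sum of absolute values. -/
theorem sum_abs_le_of_l2norm_lt (F : ∀ i, Finset (V i)) (hF : ∀ i, (F i).Nonempty)
    (h : (∀ i, V i) → ℝ) {ε : ℝ} (hε : (unifSpace F hF).l2norm h < ENNReal.ofReal ε) :
    ∑ x ∈ Fintype.piFinset F, |h x| ≤ ε * #(Fintype.piFinset F) := by
  set T := tupFinset F (ones k') with hT
  let _ : MeasurableSpace (Tup V (ones k')) := ⊤
  have : IsProbabilityMeasure (unifMeasure T) := (unifSpace F hF).isProb (ones k')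
  -- On a probability space the L¹ norm is at most the L² norm.
  have h1 : eLpNorm (fun v : Tup V (ones k') => h (toFull v)) 1 (unifMeasure T) ≤
      ENNReal.ofReal ε := by
    refine (eLpNorm_le_eLpNorm_of_exponent_le (by norm_num : (1 : ENNReal) ≤ 2) ?_).trans hε.le
    exact ((measurable_from_top (f := fun v : Tup V (ones k') =>
      h (toFull v)))).aestronglyMeasurable
  have hpos : 0 < ε := ENNReal.ofReal_pos.1 (lt_of_le_of_lt zero_le hε)
  have hT0 : (#T : ENNReal) ≠ 0 := by simpa using (tupFinset_nonempty hF (ones k')).ne_empty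
  rw [eLpNorm_one_eq_lintegral_enorm, lintegral_unifMeasure, ← ENNReal.div_eq_inv_mul,
    ENNReal.div_le_iff hT0 (ENNReal.natCast_ne_top _)] at h1
  let e : Tup V (ones k') ≃ ∀ i, V i :=
    { toFun := toFull
      invFun := fun x i _ => x i
      left_inv := fun v => by
        funext i j
        have : j = (0 : Fin 1) := Subsingleton.elim (α := Fin 1) _ _
        subst this
        rfl
      right_inv := fun x => rfl }
  have hmem : ∀ v, v ∈ T ↔ e v ∈ Fintype.piFinset F := by
    intro v
    rw [hT, mem_tupFinset, Fintype.mem_piFinset]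
    refine forall_congr' fun i => ⟨fun hv => hv _, fun hv j => ?_⟩
    have : j = (0 : Fin 1) := Subsingleton.elim (α := Fin 1) _ _
    subst this
    exact hv
  have hcard : #T = #(Fintype.piFinset F) := card_equiv e hmem
  have hsum : ∑ v ∈ T, ‖h (toFull v)‖ₑ = ∑ x ∈ Fintype.piFinset F, ‖h x‖ₑ :=
    sum_equiv e hmem fun _ _ => rfl
  rw [hsum, hcard] at h1
  have h2 : ENNReal.ofReal (∑ x ∈ Fintype.piFinset F, |h x|) ≤
      ENNReal.ofReal (ε * #(Fintype.piFinset F)) := by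
    rw [ENNReal.ofReal_sum_of_nonneg fun _ _ => abs_nonneg _, ENNReal.ofReal_mul hpos.le,
      ENNReal.ofReal_natCast]
    simpa only [Real.enorm_eq_ofReal_abs] using h1
  exact (ENNReal.ofReal_le_ofReal_iff (by positivity)).1 h2

end Uniform

/-! ### Coordinates of fibers and sums over boxes -/

section Glue

variable {k k' : ℕ} {V : Fin k' → Type u}

/-- The point with coordinates `b` in `I` and coordinates `x`, in increasing order, outside `I`. -/
def glue {V : Fin k' → Type u} (I : Finset (Fin k')) (hI : I.card + (k + 1) = k')
    (b : ∀ i : I, V i) (x : ∀ j, V (enumCompl I hI j)) (i : Fin k') : V i :=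
  if hi : i ∈ I then b ⟨i, hi⟩ else
    Equiv.piCongrLeft (fun i : (Iᶜ : Finset (Fin k')) => V i) (enumCompl I hI).toEquiv x
      ⟨i, Finset.mem_compl.mpr hi⟩

theorem glue_mem (I : Finset (Fin k')) (hI : I.card + (k + 1) = k') (b : ∀ i : I, V i)
    (x : ∀ j, V (enumCompl I hI j)) (i : I) : glue I hI b x i = b i := by
  simp [glue]

theorem glue_enumCompl (I : Finset (Fin k')) (hI : I.card + (k + 1) = k') (b : ∀ i : I, V i)
    (x : ∀ j, V (enumCompl I hI j)) (j : Fin (k + 1)) : glue I hI b x (enumCompl I hI j) = x j := by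
  have hj : (enumCompl I hI j : Fin k') ∉ I := Finset.mem_compl.1 (enumCompl I hI j).2
  rw [glue, dif_neg hj]
  exact Equiv.piCongrLeft_apply_apply (fun i : (Iᶜ : Finset (Fin k')) => V i)
    (enumCompl I hI).toEquiv x j

/-- Reduces a claim about all coordinates to those where `glue` computes, without transport between
the types `V i`. -/
theorem forall_iff_enumCompl (I : Finset (Fin k')) (hI : I.card + (k + 1) = k')
    {p : Fin k' → Prop} : (∀ i, p i) ↔ (∀ i : I, p i) ∧ ∀ j, p (enumCompl I hI j) := by
  refine ⟨fun h => ⟨fun i => h i, fun j => h _⟩, fun h i => ?_⟩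
  by_cases hi : i ∈ I
  · exact h.1 ⟨i, hi⟩
  · have := h.2 ((enumCompl I hI).symm ⟨i, Finset.mem_compl.2 hi⟩)
    rwa [OrderIso.apply_symm_apply] at this

/-- Summation over a box whose sides in `I` are single points. -/
theorem sum_piFinset_glue {M : Type*} [AddCommMonoid M] (I : Finset (Fin k'))
    (hI : I.card + (k + 1) = k') (b : ∀ i : I, V i) (A : ∀ j, Finset (V (enumCompl I hI j)))
    (φ : (∀ i, V i) → M) :
    ∑ x ∈ Fintype.piFinset (glue (V := fun i => Finset (V i)) I hI (fun i => {b i}) A), φ x =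
      ∑ y ∈ Fintype.piFinset A, φ (glue I hI b y) := by
  symm
  refine sum_bij' (fun y _ => glue I hI b y) (fun x _ j => x (enumCompl I hI j)) ?_ ?_ ?_ ?_ ?_
  · intro y hy
    rw [Fintype.mem_piFinset, forall_iff_enumCompl I hI]
    refine ⟨fun i => ?_, fun j => ?_⟩
    · rw [glue_mem (V := fun i => Finset (V i)), glue_mem]
      exact mem_singleton_self _
    · rw [glue_enumCompl (V := fun i => Finset (V i)), glue_enumCompl]
      exact Fintype.mem_piFinset.1 hy j
  · intro x hx
    rw [Fintype.mem_piFinset, forall_iff_enumCompl I hI] at hx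
    rw [Fintype.mem_piFinset]
    intro j
    have := hx.2 j
    rwa [glue_enumCompl (V := fun i => Finset (V i))] at this
  · intro y _
    funext j
    exact glue_enumCompl I hI b y j
  · intro x hx
    rw [Fintype.mem_piFinset, forall_iff_enumCompl I hI] at hx
    funext i
    revert i
    rw [forall_iff_enumCompl I hI]
    refine ⟨fun i => ?_, fun j => glue_enumCompl _ _ _ _ _⟩
    have := hx.1 i
    rw [glue_mem (V := fun i => Finset (V i)), mem_singleton] at this
    rw [glue_mem, this]
  · intro y _
    rfl

/-- Summation over a box in `k + 1` coordinates whose last side is the image of `c`. -/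
theorem sum_piFinset_snoc {W : Fin (k + 1) → Type u} {β M : Type*} [AddCommMonoid M] [Fintype β]
    (A : ∀ j : Fin k, Finset (W j.castSucc)) (c : β ↪ W (Fin.last k)) (φ : (∀ j, W j) → M) :
    ∑ y ∈ Fintype.piFinset
        (Fin.snoc (α := fun j => Finset (W j)) A (univ.map c)), φ y =
      ∑ σ, ∑ a : ∀ j : Fin k, A j, φ (Fin.snoc (α := W) (fun j => (a j : W j.castSucc)) (c σ)) := by
  classical
  rw [← sum_product' univ univ
    (fun σ (a : ∀ j : Fin k, A j) => φ (Fin.snoc (α := W) (fun j => (a j : W j.castSucc)) (c σ)))]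
  symm
  refine sum_bij (fun p _ => Fin.snoc (α := W) (fun j => (p.2 j : W j.castSucc)) (c p.1))
    ?_ ?_ ?_ ?_
  · intro p _
    rw [Fintype.mem_piFinset, Fin.forall_fin_succ']
    simp
  · rintro ⟨σ, a⟩ _ ⟨σ', a'⟩ _ h
    obtain ⟨h1, h2⟩ := Fin.snoc_injective2 h
    refine Prod.ext (c.injective h2) ?_
    funext j
    exact Subtype.ext (congrFun h1 j)
  · intro y hy
    rw [Fintype.mem_piFinset, Fin.forall_fin_succ'] at hy
    simp only [Fin.snoc_castSucc, Fin.snoc_last, mem_map, mem_univ, true_and] at hy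
    obtain ⟨h1, σ, hσ⟩ := hy
    refine ⟨(σ, fun j => ⟨y j.castSucc, h1 j⟩), mem_univ _, ?_⟩
    simp only [hσ]
    exact Fin.snoc_init_self y
  · intro p _
    rfl

end Glue

/-! ### The two bounds on the trace -/

/-- If every pattern `σ` on a `k`-dimensional box of side `d` is realized by `f σ`, with gap
`s - r`, and the functions `f σ` are on average close to functions `g σ` that are sums of `N`
products whose factors depending on `σ` do not depend on all the coordinates, then `d` is
bounded. -/
theorem exp_le_pow_of_approx {k N d : ℕ} {A : Fin k → Type*} [∀ j, Fintype (A j)]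
    [∀ j, DecidableEq (A j)]
    (hA : ∀ j, Fintype.card (A j) = d) {P : Type*} [Fintype P] (sel : P → Fin k)
    (K : Fin N → (∀ j, A j) → ℝ)
    (θ : Fin N → ∀ p : P, (∀ i : {i // i ≠ sel p}, A i) → ((∀ j, A j) → Bool) → ℝ)
    (f g : ((∀ j, A j) → Bool) → (∀ j, A j) → ℝ)
    (hg : ∀ σ a, g σ a = ∑ j, K j a * ∏ p, θ j p (fun i => a i) σ)
    (hg01 : ∀ σ a, g σ a ∈ Set.Icc (0 : ℝ) 1) {r s : ℝ} (hr0 : 0 ≤ r) (hs1 : s ≤ 1) (hrs : r < s)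
    (hfr : ∀ σ a, σ a = true → f σ a ≤ r) (hfs : ∀ σ a, σ a = false → s ≤ f σ a)
    (herr : ∑ σ, ∑ a, |f σ a - g σ a| ≤ (s - r) / 8 *
      (Fintype.card (∀ j, A j) * Fintype.card ((∀ j, A j) → Bool) : ℕ)) :
    Real.exp (((d ^ k : ℕ) : ℝ) * ((s - r) ^ 2 / 64)) ≤
      ((d + 1 : ℕ) : ℝ) ^ ((N + 1) * Fintype.card P * d ^ (k - 1)) := by
  classical
  let α := ∀ j, A j
  have hcα : Fintype.card α = d ^ k := by
    rw [Fintype.card_pi]; simp [hA]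
  -- A parameter is a value of one factor: a term, a factor, and the box coordinates other than the
  -- missed one. The extra term `none` carries the constant part of the coin bias, with all its
  -- parameters equal to 1.
  let Θ := Σ x : Option (Fin N) × P, ∀ i : {i // i ≠ sel x.2}, A i
  have hΘ : Fintype.card Θ = (N + 1) * Fintype.card P * d ^ (k - 1) := by
    rw [Fintype.card_sigma, sum_congr rfl (g := fun _ => d ^ (k - 1))]
    · simp
    · intro x _
      rw [Fintype.card_pi]
      simp only [hA, prod_const, card_univ]
      rw [Fintype.card_subtype_compl]
      simp
  -- `l` is both the size of the tilt and the allowed mean error; the midpoint `q` is at distance `4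
  -- * l` from `r` and `s`.
  set l := (s - r) / 8 with hl
  set q := (r + s) / 2 with hq
  let sg : Bool → ℝ := fun b => if b then 1 else -1
  let u : (α → Bool) → α → ℝ := fun σ a => sg (σ a) * (l * (q - g σ a))
  let τ : Option (Fin N) → α → P → Θ := fun j a p => ⟨(j, p), fun i => a i⟩
  let θ' : (α → Bool) → Θ → ℝ := fun σ t =>
    match t with
    | ⟨(none, _), _⟩ => 1
    | ⟨(some j, p), x⟩ => θ j p x σ
  let K' : Bool → Option (Fin N) → α → ℝ := fun b j a =>
    match j with
    | none => 1 / 2 * (1 + sg b * (l * q))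
    | some j => -(1 / 2 * (sg b * l)) * K j a
  let z : Bool → (α → Bool) → α → ℝ := fun b σ a => 1 / 2 * (1 + sg b * (l * (q - g σ a)))
  have hsg : ∀ b, |sg b| = 1 := by intro b; cases b <;> simp [sg]
  have hl0 : 0 ≤ l := by rw [hl]; linarith
  have hl8 : l ≤ 1 / 8 := by rw [hl]; linarith
  have hb : ∀ b σ a, |sg b * (l * (q - g σ a))| ≤ l := by
    intro b σ a
    obtain ⟨h0, h1⟩ := hg01 σ a
    have h2 : |q - g σ a| ≤ 1 := by
      rw [abs_le]; constructor <;> rw [hq] <;> linarith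
    rw [abs_mul, hsg, one_mul, abs_mul, abs_of_nonneg hl0]
    nlinarith
  have h1 : ∑ σ : α → Bool, ∏ a, z (σ a) σ a ≤ ((d + 1 : ℕ) : ℝ) ^ Fintype.card Θ := by
    refine sum_prod_le_pow τ θ' K' z d ?_ ?_ ?_ ?_
    · intro b σ a
      rw [Fintype.sum_option]
      have h2 : ∀ j, ∏ p, θ' σ (τ (some j) a p) = ∏ p, θ j p (fun i => a i) σ := fun j => rfl
      have h3 : ∏ p, θ' σ (τ none a p) = 1 := prod_eq_one fun p _ => rfl
      simp only [h2, h3, z, K', hg, mul_assoc (-(1 / 2 * (sg b * l))), ← mul_sum]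
      ring
    · intro b σ a
      have := (abs_le.1 (hb b σ a)).1
      simp only [z]
      linarith
    · intro σ a
      simp only [z, sg, if_true, Bool.false_eq_true, if_false]
      ring
    · intro ι t
      -- The parameter `t` fixes the factor and all coordinates of `a` but one, leaving at most `d`
      -- pairs. `val` reads off coordinates as a non-dependent function of `t`, so equal parameters
      -- can be compared without casts.
      let val : Θ → ∀ i, Option (A i) := fun t i =>
        if h : i ≠ sel t.1.2 then some (t.2 ⟨i, h⟩) else none
      refine (card_le_card_of_injOn (t := (univ : Finset (A (sel t.1.2))))
        (fun x => x.1 (sel t.1.2)) (fun _ _ => mem_univ _) ?_).trans_eq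
        (by rw [card_univ, hA])
      intro x hx y hy hxy
      have hx' : τ (ι x.1) x.1 x.2 = t := by simpa using hx
      have hy' : τ (ι y.1) y.1 y.2 = t := by simpa using hy
      have hx2 : x.2 = t.1.2 := congrArg (fun t : Θ => t.1.2) hx'
      have hy2 : y.2 = t.1.2 := congrArg (fun t : Θ => t.1.2) hy'
      refine Prod.ext ?_ (hx2.trans hy2.symm)
      funext i
      by_cases hi : i = sel t.1.2
      · subst hi; exact hxy
      · have h2 : val (τ (ι x.1) x.1 x.2) i = val (τ (ι y.1) y.1 y.2) i := by rw [hx', hy']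
        have hxi : i ≠ sel x.2 := by rwa [hx2]
        have hyi : i ≠ sel y.2 := by rwa [hy2]
        simp only [val, τ, dif_pos hxi, dif_pos hyi] at h2
        exact Option.some_injective _ h2
  -- The gap contributes `l * (4 * l)` and the mean error costs at most `l * l`.
  have h2 := exp_le_sum_prod u (c := l * (3 * l)) hl8 (fun σ a => hb _ σ a) (by
    have h3 : ∀ σ a, l * (4 * l) - l * |f σ a - g σ a| ≤ u σ a := by
      intro σ a
      rw [← mul_sub]
      cases h : σ a
      · have := hfs σ a h
        have h4 := le_abs_self (f σ a - g σ a)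
        simp only [u, sg, h, Bool.false_eq_true, if_false]
        rw [neg_one_mul, ← mul_neg]
        refine mul_le_mul_of_nonneg_left ?_ hl0
        rw [hl, hq]; linarith
      · have := hfr σ a h
        have h4 := neg_abs_le (f σ a - g σ a)
        simp only [u, sg, h, if_true]
        rw [one_mul]
        refine mul_le_mul_of_nonneg_left ?_ hl0
        rw [hl, hq]; linarith
    refine le_trans ?_ (sum_le_sum fun σ _ => sum_le_sum fun a _ => h3 σ a)
    simp only [sum_sub_distrib, sum_const, card_univ, nsmul_eq_mul, ← mul_sum]
    have h5 := mul_le_mul_of_nonneg_left herr hl0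
    push_cast at h5
    simp only [Fintype.card_fun, Fintype.card_bool, Nat.cast_pow] at h5 ⊢
    linarith)
  -- The factors 1/2 in `z` multiply to the reciprocal of the number of patterns.
  have h3 : ∑ σ, ∏ a, (1 + u σ a) =
      Fintype.card (α → Bool) * ∑ σ : α → Bool, ∏ a, z (σ a) σ a := by
    rw [mul_sum]
    refine sum_congr rfl fun σ _ => ?_
    simp only [z, prod_mul_distrib, prod_const, card_univ, Fintype.card_fun, Fintype.card_bool]
    rw [← mul_assoc]
    push_cast
    rw [← mul_pow]
    norm_num
    rfl
  rw [h3] at h2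
  have h4 := (le_of_mul_le_mul_left h2 (by positivity)).trans h1
  rw [hΘ, hcα] at h4
  have h5 : l * (3 * l) - 2 * l ^ 2 = (s - r) ^ 2 / 64 := by rw [hl]; ring
  rwa [h5] at h4

/-! ### From a shattered box to the contradiction -/

variable {k k' : ℕ} {V : Fin k' → Type u}

/-- A function that is uniformly approximable over all uniform spaces on finite sets satisfies a
bound on the sides of the boxes shattered by its fibers. -/
theorem not_shatters_of_approximable (f : (∀ i, V i) → ℝ) {r s : ℝ} (hr0 : 0 ≤ r) (hs1 : s ≤ 1)
    (hrs : r < s) {N d : ℕ} (hd0 : 0 < d)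
    (hd : ∀ n : ℕ, n ≤ k * ((N + 1) * 2 ^ k') * d ^ (k - 1) →
      ((d + 1 : ℕ) : ℝ) ^ n < Real.exp (((d ^ k : ℕ) : ℝ) * ((s - r) ^ 2 / 64)))
    (happ : ∀ (F : ∀ i, Finset (V i)) (hF : ∀ i, (F i).Nonempty),
      (unifSpace F hF).Approximable k f ((s - r) / 8) N)
    (I : Finset (Fin k')) (hI : I.card + (k + 1) = k') (b : ∀ i : I, V i)
    (A : ∀ j : Fin k, Finset (V (enumCompl I hI j.castSucc))) (hA : ∀ j, #(A j) = d) :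
    ¬ Shatters (W := fun j => V (enumCompl I hI j)) (fiber f I hI b) r s A := by
  classical
  intro hsh
  let W : Fin (k + 1) → Type u := fun j => V (enumCompl I hI j)
  let α := ∀ j : Fin k, A j
  let pt : α → W (Fin.last k) → ∀ i, V i := fun a y =>
    glue I hI b (Fin.snoc (α := W) (fun j => (a j : W j.castSucc)) y)
  have hα : Nonempty α := by
    refine ⟨fun j => Classical.choice ?_⟩
    have : (A j).Nonempty := card_pos.1 (by rw [hA]; exact hd0)
    exact this.to_subtype
  have hc : ∀ σ : α → Bool, ∃ y : W (Fin.last k),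
      (∀ a, σ a = true → f (pt a y) ≤ r) ∧ (∀ a, σ a = false → s ≤ f (pt a y)) := by
    intro σ
    obtain ⟨y, h1, h2⟩ := hsh {x | ∃ a : α, σ a = true ∧ x = fun j => (a j : W j.castSucc)} (by
      rintro x ⟨a, -, rfl⟩ j
      exact (a j).2)
    refine ⟨y, fun a ha => h1 _ ⟨a, ha, rfl⟩, fun a ha => h2 _ ⟨fun j => (a j).2, ?_⟩⟩
    rintro ⟨a', ha', he⟩
    have : a = a' := by
      funext j
      exact Subtype.ext (congrFun he j)
    rw [this, ha'] at ha
    cases ha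
  choose c hcr hcs using hc
  -- As `r < s`, a witness determines its pattern, so uniform measure on the witnesses averages
  -- uniformly over patterns.
  have hcinj : Function.Injective c := by
    intro σ σ' h
    funext a
    have h1 := hcr σ a
    have h2 := hcs σ a
    have h3 := hcr σ' a
    have h4 := hcs σ' a
    rw [h] at h1 h2
    cases h5 : σ a <;> cases h6 : σ' a
    · rfl
    · have := h2 h5; have := h3 h6; linarith
    · have := h1 h5; have := h4 h6; linarith
    · rfl
  let C : ∀ j, Finset (W j) := Fin.snoc (α := fun j => Finset (W j)) A (univ.map ⟨c, hcinj⟩)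
  have hC : ∀ j, (C j).Nonempty := by
    rw [Fin.forall_fin_succ']
    refine ⟨fun j => ?_, ?_⟩
    · simp only [C, Fin.snoc_castSucc]
      exact card_pos.1 (by rw [hA]; exact hd0)
    · simp only [C, Fin.snoc_last]
      exact univ_nonempty.map
  let F : ∀ i, Finset (V i) := glue (V := fun i => Finset (V i)) I hI (fun i => {b i}) C
  have hF : ∀ i, (F i).Nonempty := by
    rw [forall_iff_enumCompl I hI]
    refine ⟨fun i => ?_, fun j => ?_⟩
    · simp only [F]
      rw [glue_mem (V := fun i => Finset (V i))]
      exact singleton_nonempty _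
    · simp only [F]
      rw [glue_enumCompl (V := fun i => Finset (V i))]
      exact hC j
  have hsum : ∀ φ : (∀ i, V i) → ℝ,
      ∑ x ∈ Fintype.piFinset F, φ x = ∑ σ, ∑ a, φ (pt a (c σ)) := by
    intro φ
    rw [sum_piFinset_glue]
    exact sum_piFinset_snoc (W := W) A ⟨c, hcinj⟩ _
  obtain ⟨γ, φ, g, -, hg, hg01, hfg⟩ := happ F hF
  have herr := sum_abs_le_of_l2norm_lt F hF _ hfg
  have hcard : (#(Fintype.piFinset F) : ℝ) =
      (Fintype.card α * Fintype.card (α → Bool) : ℕ) := by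
    rw [card_eq_sum_ones, Nat.cast_sum]
    rw [hsum]
    simp [mul_comm]
  rw [hcard, hsum] at herr
  let ℓ : Fin k' := enumCompl I hI (Fin.last k)
  let P := {I' : Finset (Fin k') // #I' ≤ k ∧ ℓ ∈ I'}
  -- A set of at most `k` coordinates containing `ℓ` cannot contain all `k + 1` free coordinates.
  have hsel : ∀ p : P, ∃ j : Fin k, (enumCompl I hI j.castSucc : Fin k') ∉ p.1 := by
    rintro ⟨I', h1, h2⟩
    by_contra! h3
    have h4 : ∀ j, (enumCompl I hI j : Fin k') ∈ I' := by
      rw [Fin.forall_fin_succ']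
      exact ⟨h3, h2⟩
    have h5 := card_le_card_of_injOn (s := univ) (t := I')
      (fun j => (enumCompl I hI j : Fin k')) (fun j _ => h4 j)
      (fun x _ y _ h => (enumCompl I hI).injective (Subtype.ext h))
    simp at h5
    omega
  choose sel hsel using hsel
  let a₀ : α := Classical.choice hα
  have hptI : ∀ a y (i : I), pt a y i = b i := fun a y i => glue_mem I hI b _ i
  have hptj : ∀ a y (j : Fin k), pt a y (enumCompl I hI j.castSucc) = a j := by
    intro a y j
    refine (glue_enumCompl I hI b _ _).trans ?_
    exact Fin.snoc_castSucc (α := W) _ _ _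
  have hptl : ∀ a y, pt a y (enumCompl I hI (Fin.last k)) = y := by
    intro a y
    refine (glue_enumCompl I hI b _ _).trans ?_
    exact Fin.snoc_last (α := W) _ _
  have key := exp_le_pow_of_approx (A := fun j => A j) (N := N) (d := d) (P := P)
    (fun j => by rw [Fintype.card_coe, hA]) sel
    -- Factors without `ℓ` do not see the witness, so any pattern serves there; below, `a₀` fills
    -- the coordinate that the factor misses.
    (fun j a => γ j * ∏ I' ∈ univ.filter (fun I' : Finset (Fin k') => #I' ≤ k) with ℓ ∉ I',
      φ j I' (fun i => pt a (c fun _ => true) i))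
    (fun j p x σ => φ j p.1 fun i =>
      pt (fun j => if h : j ≠ sel p then x ⟨j, h⟩ else a₀ j) (c σ) i)
    (fun σ a => f (pt a (c σ))) (fun σ a => g (pt a (c σ))) ?_ (fun _ _ => hg01 _) hr0 hs1 hrs
    (fun σ a h => hcr σ a h) (fun σ a h => hcs σ a h) herr
  · refine absurd key (not_le.2 (hd _ (Nat.mul_le_mul_right _ ?_)))
    have hP : Fintype.card P ≤ k * 2 ^ k' := by
      rcases Nat.eq_zero_or_pos k with hk | hk
      -- For `k = 0` there is no coordinate to miss, hence no such factor.
      · have : IsEmpty P := ⟨fun p => by have := (sel p).2; omega⟩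
        simp
      · calc Fintype.card P ≤ Fintype.card (Finset (Fin k')) := Fintype.card_subtype_le _
          _ = 2 ^ k' := by simp
          _ ≤ k * 2 ^ k' := Nat.le_mul_of_pos_left _ hk
    calc (N + 1) * Fintype.card P ≤ (N + 1) * (k * 2 ^ k') := Nat.mul_le_mul_left _ hP
      _ = k * ((N + 1) * 2 ^ k') := by ring
  · intro σ a
    rw [hg]
    refine sum_congr rfl fun j _ => ?_
    rw [mul_assoc, ← prod_filter_mul_prod_filter_not
      (univ.filter (fun I' : Finset (Fin k') => #I' ≤ k)) (fun I' => ℓ ∈ I'),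
      mul_comm (∏ _ ∈ filter (fun I' => ℓ ∈ I') _, _)]
    congr 2
    · refine prod_congr rfl fun I' hI' => ?_
      congr 1
      funext ⟨i, hi⟩
      have hil : i ≠ ℓ := by
        rintro rfl
        exact (mem_filter.1 hI').2 hi
      revert hil
      change i ≠ ℓ → pt a (c σ) i = pt a (c fun _ => true) i
      clear hi
      revert i
      rw [forall_iff_enumCompl I hI, Fin.forall_fin_succ']
      refine ⟨fun i _ => by rw [hptI, hptI], fun j _ => by rw [hptj, hptj], fun h => ?_⟩
      exact absurd rfl h
    · rw [filter_filter, prod_subtype (p := fun I' => #I' ≤ k ∧ ℓ ∈ I') _ (by simp)]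
      refine prod_congr rfl fun p _ => ?_
      congr 1
      funext ⟨i, hi⟩
      have hip : i ≠ enumCompl I hI (sel p).castSucc := by
        rintro rfl
        exact hsel p hi
      revert hip
      change _ → pt a (c σ) i = pt _ (c σ) i
      clear hi
      revert i
      rw [forall_iff_enumCompl I hI, Fin.forall_fin_succ']
      refine ⟨fun i _ => by rw [hptI, hptI], fun j hj => ?_, fun _ => by rw [hptl, hptl]⟩
      have : j ≠ sel p := by
        rintro rfl
        exact hj rfl
      rw [hptj, hptj, dif_pos this]

end GradedVC

theorem mainTheorem4 {k k' : ℕ} (hk : k < k') (V : Fin k' → Type u)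
    (f : (∀ i, V i) → ℝ) (hf : ∀ x, f x ∈ Set.Icc (0 : ℝ) 1) :
    ((∀ ε : ℝ, 0 < ε → ∃ N : ℕ, ∀ P : GradedVC.GradedProbSpace V,
        P.MeasurableFull f → P.Approximable k f ε N) →
      GradedVC.FiniteVC k f) ∧
    ((∀ ε : ℝ, 0 < ε → ∃ N : ℕ, ∀ P : GradedVC.GradedProbSpace V,
        P.IsDiscrete → P.FinitelySupported → P.Approximable k f ε N) →
      GradedVC.FiniteVC k f) := by
  have main : (∀ ε : ℝ, 0 < ε → ∃ N : ℕ, ∀ P : GradedVC.GradedProbSpace V,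
        P.IsDiscrete → P.FinitelySupported → P.Approximable k f ε N) →
      GradedVC.FiniteVC k f := by
    intro h
    have hd : ∀ r s : ℝ, ∃ d : ℕ, 0 ≤ r → s ≤ 1 → r < s →
        ∀ (I : Finset (Fin k')) (hI : I.card + (k + 1) = k') (b : ∀ i : I, V i)
          (A : ∀ j : Fin k, Finset (V (GradedVC.enumCompl I hI j.castSucc))),
          (∀ j, (A j).card = d) →
          ¬ GradedVC.Shatters (W := fun j => V (GradedVC.enumCompl I hI j))
            (GradedVC.fiber f I hI b) r s A := by
      intro r s
      by_cases hrs : r < s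
      · obtain ⟨N, hN⟩ := h ((s - r) / 8) (by linarith)
        have hpos : 0 < (s - r) ^ 2 / 64 := by have := sub_pos.2 hrs; positivity
        obtain ⟨d, hd0, hd⟩ := GradedVC.exists_pow_lt_exp k ((N + 1) * 2 ^ k') hpos
        refine ⟨d, fun hr0 hs1 _ => ?_⟩
        exact GradedVC.not_shatters_of_approximable f hr0 hs1 hrs hd0 hd fun F hF =>
          hN _ (GradedVC.unifSpace_isDiscrete F hF) (GradedVC.unifSpace_finitelySupported F hF)
      -- Dummy value: only `r < s` matters.
      · exact ⟨0, fun _ _ h' => absurd h' hrs⟩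
    choose d hd using hd
    refine ⟨d, fun I hI b r hr s hs hrs => ?_⟩
    rintro ⟨A, hA, hsh⟩
    exact hd r s hr.1 hs.2 hrs I hI b A hA hsh
  -- On a discrete space `f` is automatically measurable, so the first claim follows from the
  -- second.
  refine ⟨fun h => main fun ε hε => ?_, main⟩
  obtain ⟨N, hN⟩ := h ε hε
  refine ⟨N, fun P hP _ => hN P ?_⟩
  unfold GradedVC.GradedProbSpace.MeasurableFull
  rw [hP]
  exact measurable_from_top
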